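/- Let $d\ge 3$ and let $K\subset\mathbb{R}^d$ be a bounded Lebesgue measurable set. Then for almost every $\theta\in S^{d-1}$ (with respect to surface measure) the following holds: for every $r\in\mathbb{R}$ the section $K\cap\{x\in\mathbb{R}^d:\langle x,\theta\rangle=r\}$ is Lebesgue measurable in the hyperplane $\{x:\langle x,\theta\rangle=r\}$, and the Radon transform of $\chi_K$ in direction $\theta$, $$(R_\theta\chi_K)(r)=\lambda^{d-1}\bigl(K\cap\{x\in\mathbb{R}^d:\langle x,\theta\rangle=r\}\bigr)\qquad(r\in\mathbb{R}),$$ where $\lambda^{d-1}$ is $(d-1)$-dimensional Lebesgue measure on the hyperplane, is an absolutely continuous function on $\mathbb{R}$: for every $\varepsilon>0$ there is a $\delta>0$ such that $\sum_{i=1}^n|(R_\theta\chi_K)(b_i)-(R_\theta\chi_K)(a_i)|<\varepsilon$ for all finite families of pairwise disjoint intervals $(a_i,b_i]$ with $\sum_{i=1}^n(b_i-a_i)<\delta$. -/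

import Mathlib

open MeasureTheory

/-- Absolute continuity of a function on the whole real line: for every `ε > 0` there is `δ > 0`
such that for every finite family of pairwise disjoint intervals `(a i, b i]` of total length less
than `δ`, the sum of the increments `|f (b i) - f (a i)|` is less than `ε`. (For `a i ≤ b i` it is
immaterial whether half-open or open intervals are taken.) -/
def AbsolutelyContinuousOnLine (f : ℝ → ℝ) : Prop :=
  ∀ ε > 0, ∃ δ > 0, ∀ (n : ℕ) (a b : Fin n → ℝ),
    (∀ i, a i ≤ b i) →
    (∀ i j, i ≠ j → Disjoint (Set.Ioc (a i) (b i)) (Set.Ioc (a j) (b j))) →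
    ∑ i, (b i - a i) < δ →
    ∑ i, |f (b i) - f (a i)| < ε

/-- The section `K ∩ {x | ⟪x, θ⟫ = r}` of a set `K ⊆ ℝᵈ` by an affine hyperplane. -/
def hyperplaneSection {d : ℕ} (K : Set (EuclideanSpace ℝ (Fin d)))
    (θ : EuclideanSpace ℝ (Fin d)) (r : ℝ) : Set (EuclideanSpace ℝ (Fin d)) :=
  K ∩ {x | inner ℝ x θ = r}

/-- The Radon transform of the characteristic function of `K ⊆ ℝᵈ` in direction `θ`: the function
`r ↦ λᵈ⁻¹(K ∩ {x | ⟪x, θ⟫ = r})`. Here `μHE[d - 1]` is the `(d - 1)`-dimensional Hausdorff measure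
normalized so that it is Lebesgue measure on every `(d - 1)`-dimensional affine subspace. For
bounded `K` and a unit vector `θ` the measure is finite, so passing to `ℝ` loses nothing. -/
noncomputable def radonTransform {d : ℕ} (K : Set (EuclideanSpace ℝ (Fin d)))
    (θ : EuclideanSpace ℝ (Fin d)) (r : ℝ) : ℝ :=
  (μHE[d - 1] (hyperplaneSection K θ r)).toReal

/-! By the Fourier slice theorem, the 1D Fourier transform of the Radon transform of `f` in
direction `θ` is `σ ↦ 𝓕 f (σ • θ)`. Integrating `(1 + σ²)|𝓕 f (σ • θ)|²` over the sphere and using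
polar coordinates, `d ≥ 3` gives `σ² ≤ |σ|^(d-1)` for `|σ| ≥ 1`, so Plancherel bounds the average by
the L¹ and L² norms of `f` (`lintegral_lineEnergy_le`). Hence Radon transforms lie in H¹(ℝ) for
almost every direction, with two consequences: a sup bound in `r` (`sq_enorm_fourierInv_le`), and
control of increments by the L² norm of the derivative (`sq_sum_enorm_fourierInv_sub_le`).

The difficulty is to treat every `r` outside a single null set of directions. Squeeze `K` between
compact `C n` and open `U n` with gap of volume below `2⁻ⁿ`. The sup bound, summed over `n`, shows
that for almost every `θ` all sections of `U n \ C n` shrink to measure zero. So every section of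
`K` is measurable, and the Radon transforms of smooth functions between the indicators of `C n` and
`U n` converge at every `r`. Fatou makes their energies bounded along a subsequence, and the
increment bound passes to the limit. -/

open MeasureTheory Filter
open scoped FourierTransform SchwartzMap RealInnerProductSpace ENNReal Topology

/-! ### Hyperplane integrals and the Fourier slice theorem. -/

section Hyperplane

variable {E : Type*} [NormedAddCommGroup E] [InnerProductSpace ℝ E] [FiniteDimensional ℝ E]
  [MeasurableSpace E] [BorelSpace E]

/-- Lebesgue measure on the hyperplane `{x | ⟪x, θ⟫ = r}`, as a measure on the ambient space. -/
noncomputable def hyperplaneMeasure (θ : E) (r : ℝ) : Measure E :=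
  Measure.map (fun y : (ℝ ∙ θ)ᗮ => r • θ + (y : E)) volume

omit [FiniteDimensional ℝ E] [MeasurableSpace E] [BorelSpace E] in
theorem isometry_hyperplane_parametrization (θ : E) (r : ℝ) :
    Isometry fun y : (ℝ ∙ θ)ᗮ => r • θ + (y : E) :=
  (isometry_add_left (r • θ)).comp isometry_subtype_coe

omit [FiniteDimensional ℝ E] [MeasurableSpace E] [BorelSpace E] in
theorem range_hyperplane_parametrization {θ : E} (hθ : ‖θ‖ = 1) (r : ℝ) :
    Set.range (fun y : (ℝ ∙ θ)ᗮ => r • θ + (y : E)) = {x | inner ℝ x θ = r} := by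
  ext x
  constructor
  · rintro ⟨y, rfl⟩
    have : inner ℝ (y : E) θ = 0 := Submodule.mem_orthogonal_singleton_iff_inner_left.1 y.2
    simp [inner_add_left, inner_smul_left, this, hθ]
  · intro hx
    refine ⟨⟨x - r • θ, Submodule.mem_orthogonal_singleton_iff_inner_left.2 ?_⟩, by simp⟩
    have hx' : inner ℝ x θ = r := hx
    simp [inner_sub_left, inner_smul_left, hx', hθ]

/-- Isometries carry Hausdorff measure to its restriction to their range; this links the
parametrized measure to the one in `radonTransform`. -/
theorem hyperplaneMeasure_eq_restrict {θ : E} (hθ : ‖θ‖ = 1) (r : ℝ) :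
    hyperplaneMeasure θ r =
      (μHE[Module.finrank ℝ E - 1] : Measure E).restrict {x | inner ℝ x θ = r} := by
  have hne : θ ≠ 0 := by rintro rfl; simp at hθ
  have hr : Module.finrank ℝ (ℝ ∙ θ)ᗮ = Module.finrank ℝ E - 1 := by
    rw [← (ℝ ∙ θ).finrank_add_finrank_orthogonal, finrank_span_singleton hne,
      Nat.add_sub_cancel_left]
  rw [hyperplaneMeasure, ← InnerProductSpace.euclideanHausdorffMeasure_eq_volume, hr,
    (isometry_hyperplane_parametrization θ r).map_euclideanHausdorffMeasure,
    range_hyperplane_parametrization hθ]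

theorem measurePreserving_hyperplane_decomposition {θ : E} (hθ : ‖θ‖ = 1) :
    MeasurePreserving (fun p : ℝ × (ℝ ∙ θ)ᗮ => p.1 • θ + (p.2 : E)) volume volume := by
  have h1 := ((LinearIsometryEquiv.toSpanUnitSingleton (𝕜 := ℝ) θ hθ).measurePreserving).prod
    (MeasurePreserving.id (volume : Measure (ℝ ∙ θ)ᗮ))
  have h2 := ((ℝ ∙ θ).measurePreserving_measurableEquivProd (0 : E)).symm
  rw [InnerProductSpace.euclideanHausdorffMeasure_eq_volume] at h2
  have h3 := h2.comp h1
  convert! h3 using 1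
  ext p
  simp

theorem integral_hyperplaneMeasure (θ : E) (r : ℝ) {F : Type*} [NormedAddCommGroup F]
    [NormedSpace ℝ F] (f : E → F) :
    ∫ x, f x ∂hyperplaneMeasure θ r = ∫ y : (ℝ ∙ θ)ᗮ, f (r • θ + (y : E)) := by
  rw [hyperplaneMeasure, MeasurableEmbedding.integral_map]
  exact (isometry_hyperplane_parametrization θ r).isClosedEmbedding.measurableEmbedding

theorem hyperplaneMeasure_lt_top_of_isBounded (θ : E) (r : ℝ) {s : Set E}
    (hs : Bornology.IsBounded s) : hyperplaneMeasure θ r s < ∞ := by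
  have hi := isometry_hyperplane_parametrization θ r
  rw [hyperplaneMeasure, hi.isClosedEmbedding.measurableEmbedding.map_apply]
  exact (hi.antilipschitz.isBounded_preimage hs).measure_lt_top

omit [FiniteDimensional ℝ E] [MeasurableSpace E] [BorelSpace E] in
theorem norm_le_norm_hyperplane_parametrization (θ : E) (r : ℝ) (y : (ℝ ∙ θ)ᗮ) :
    ‖y‖ ≤ ‖r • θ + (y : E)‖ := by
  have h : inner ℝ (r • θ) (y : E) = 0 := by
    rw [inner_smul_left, Submodule.mem_orthogonal_singleton_iff_inner_right.1 y.2, mul_zero]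
  refine (sq_le_sq₀ (norm_nonneg _) (norm_nonneg _)).1 ?_
  rw [norm_add_sq_real, h, Submodule.coe_norm]
  nlinarith [sq_nonneg ‖r • θ‖]

/-- A continuous function with compact support has a continuous Radon transform. -/
theorem continuous_integral_hyperplaneMeasure (θ : E) {f : E → ℂ}
    (hf : Continuous f) (hfc : HasCompactSupport f) :
    Continuous fun r => ∫ x, f x ∂hyperplaneMeasure θ r := by
  simp_rw [integral_hyperplaneMeasure]
  obtain ⟨R, hR⟩ := hfc.isCompact.isBounded.subset_closedBall 0
  -- Since `‖y‖ ≤ ‖r • θ + y‖`, one compact domain of integration serves all `r`.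
  have h : ∀ r : ℝ, ∫ y : (ℝ ∙ θ)ᗮ, f (r • θ + (y : E)) =
      ∫ y : (ℝ ∙ θ)ᗮ in Metric.closedBall 0 R, f (r • θ + (y : E)) := by
    intro r
    refine (setIntegral_eq_integral_of_forall_compl_eq_zero fun y hy => ?_).symm
    by_contra hne
    refine hy (mem_closedBall_zero_iff.2 ?_)
    exact (norm_le_norm_hyperplane_parametrization θ r y).trans
      (mem_closedBall_zero_iff.1 (hR (subset_tsupport f hne)))
  simp_rw [h]
  exact continuous_parametric_integral_of_continuous
    (f := fun (r : ℝ) (y : (ℝ ∙ θ)ᗮ) => f (r • θ + (y : E)))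
    (by unfold Function.uncurry; fun_prop) (isCompact_closedBall _ _)

theorem integrable_integral_hyperplaneMeasure {θ : E} (hθ : ‖θ‖ = 1) {f : E → ℂ}
    (hf : Integrable f) : Integrable fun r => ∫ x, f x ∂hyperplaneMeasure θ r := by
  simp_rw [integral_hyperplaneMeasure]
  have h := (measurePreserving_hyperplane_decomposition hθ).integrable_comp_of_integrable hf
  exact h.integral_prod_left

theorem integral_integral_hyperplaneMeasure {θ : E} (hθ : ‖θ‖ = 1) {f : E → ℂ}
    (hf : Integrable f) : ∫ r, ∫ x, f x ∂hyperplaneMeasure θ r = ∫ x, f x := by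
  simp_rw [integral_hyperplaneMeasure]
  have hm := measurePreserving_hyperplane_decomposition hθ
  have h := hm.integrable_comp_of_integrable hf
  rw [← hm.map_eq, integral_map hm.measurable.aemeasurable (by rw [hm.map_eq]; exact hf.1),
    Measure.volume_eq_prod]
  exact (integral_prod _ h).symm

/-- The Fourier slice theorem. -/
theorem fourier_integral_hyperplaneMeasure {θ : E} (hθ : ‖θ‖ = 1) {f : E → ℂ}
    (hf : Integrable f) (σ : ℝ) :
    𝓕 (fun r : ℝ => ∫ x, f x ∂hyperplaneMeasure θ r) σ = 𝓕 f (σ • θ) := by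
  have hg : Integrable fun x : E => Real.fourierChar (-⟪x, σ • θ⟫) • f x :=
    (Real.fourierIntegral_convergent_iff (σ • θ)).2 hf
  rw [Real.fourier_real_eq, Real.fourier_eq, ← integral_integral_hyperplaneMeasure hθ hg]
  congr 1
  ext r
  simp_rw [integral_hyperplaneMeasure, Circle.smul_def]
  rw [← integral_smul]
  congr 1
  ext y
  have h : ⟪(y : E), θ⟫ = 0 := Submodule.mem_orthogonal_singleton_iff_inner_left.1 y.2
  simp [inner_add_left, inner_smul_left, inner_smul_right, h, hθ, mul_comm]

omit [FiniteDimensional ℝ E] [MeasurableSpace E] [BorelSpace E] in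
theorem isometry_line {θ : E} (hθ : ‖θ‖ = 1) : Isometry fun σ : ℝ => σ • θ :=
  Isometry.of_dist_eq fun a b => by
    rw [dist_eq_norm, ← sub_smul, norm_smul, hθ, mul_one, Real.dist_eq, Real.norm_eq_abs]

/-- The restriction of the Fourier transform of a Schwartz function to a line through the
origin. -/
noncomputable def fourierLine {θ : E} (hθ : ‖θ‖ = 1) (f : 𝓢(E, ℂ)) : 𝓢(ℝ, ℂ) :=
  SchwartzMap.compCLMOfAntilipschitz ℂ (g := fun σ : ℝ => σ • θ) (by fun_prop)
    (isometry_line hθ).antilipschitz (𝓕 f)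

theorem fourierLine_apply {θ : E} (hθ : ‖θ‖ = 1) (f : 𝓢(E, ℂ)) (σ : ℝ) :
    fourierLine hθ f σ = 𝓕 f (σ • θ) := rfl

/-- Continuity in `r` makes Fourier inversion valid at every `r`, not merely almost everywhere. -/
theorem integral_hyperplaneMeasure_eq_fourierInv {θ : E} (hθ : ‖θ‖ = 1) (f : 𝓢(E, ℂ))
    (hfc : HasCompactSupport f) (r : ℝ) :
    ∫ x, f x ∂hyperplaneMeasure θ r = 𝓕⁻ (fourierLine hθ f) r := by
  have h : 𝓕 (fun r : ℝ => ∫ x, f x ∂hyperplaneMeasure θ r) = fourierLine hθ f := by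
    ext σ
    rw [fourier_integral_hyperplaneMeasure hθ f.integrable, fourierLine_apply,
      SchwartzMap.fourier_coe]
  have := congrFun ((continuous_integral_hyperplaneMeasure θ f.continuous hfc).fourierInv_fourier_eq
    (integrable_integral_hyperplaneMeasure hθ f.integrable)
    (by rw [h]; exact (fourierLine hθ f).integrable)) r
  rw [← this, h, SchwartzMap.fourierInv_coe]

end Hyperplane

theorem sq_lintegral_mul_le {α : Type*} [MeasurableSpace α] (μ : Measure α) {f g : α → ℝ≥0∞}
    (hf : AEMeasurable f μ) (hg : AEMeasurable g μ) :
    (∫⁻ a, f a * g a ∂μ) ^ 2 ≤ (∫⁻ a, f a ^ 2 ∂μ) * ∫⁻ a, g a ^ 2 ∂μ := by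
  have h := ENNReal.lintegral_mul_le_Lp_mul_Lq μ Real.HolderConjugate.two_two hf hg
  have h2 := pow_le_pow_left' h 2
  rw [mul_pow, ← ENNReal.rpow_natCast, ← ENNReal.rpow_natCast, ← ENNReal.rpow_natCast,
    ← ENNReal.rpow_mul, ← ENNReal.rpow_mul] at h2
  simpa using h2

theorem SchwartzMap.lintegral_enorm_sq {V : Type*} [NormedAddCommGroup V] [InnerProductSpace ℝ V]
    [FiniteDimensional ℝ V] [MeasurableSpace V] [BorelSpace V] (f : 𝓢(V, ℂ)) :
    ∫⁻ x, ‖f x‖ₑ ^ 2 = ENNReal.ofReal (∫ x, ‖f x‖ ^ 2) := by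
  have hi : Integrable fun x => ‖f x‖ ^ 2 := (f.memLp 2 volume).integrable_norm_pow two_ne_zero
  rw [ofReal_integral_eq_lintegral_ofReal hi (ae_of_all _ fun _ => by positivity)]
  simp_rw [ENNReal.ofReal_pow (norm_nonneg _), ofReal_norm]

/-! ### One-dimensional Sobolev estimates on the Fourier side. -/

section OneDimensional

theorem hasDerivAt_fourierInv_schwartz (g : 𝓢(ℝ, ℂ)) (r : ℝ) :
    HasDerivAt (𝓕⁻ g : 𝓢(ℝ, ℂ))
      (𝓕⁻ ((2 * Real.pi * Complex.I) • SchwartzMap.smulLeftCLM ℂ (inner ℝ · (1 : ℝ)) g) r) r := by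
  rw [← SchwartzMap.lineDerivOp_fourierInv_eq]
  exact ((𝓕⁻ g).differentiable r).hasDerivAt

/-- Sobolev embedding of H¹(ℝ) in L^∞: Cauchy–Schwarz with weight `√(1 + σ²)`, where `π = ∫ (1 +
σ²)⁻¹`. -/
theorem sq_enorm_fourierInv_le (g : 𝓢(ℝ, ℂ)) (r : ℝ) :
    ‖𝓕⁻ g r‖ₑ ^ 2 ≤
      ENNReal.ofReal Real.pi * ∫⁻ σ, ENNReal.ofReal (1 + σ ^ 2) * ‖g σ‖ₑ ^ 2 := by
  have h1 : ‖𝓕⁻ g r‖ₑ ≤ ∫⁻ σ, ‖g σ‖ₑ := by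
    rw [SchwartzMap.fourierInv_coe, Real.fourierInv_eq]
    refine (enorm_integral_le_lintegral_enorm _).trans (lintegral_mono fun σ => ?_)
    rw [Circle.smul_def, enorm_smul]
    rw [← ofReal_norm, Circle.norm_coe, ENNReal.ofReal_one, one_mul]
  have hw : ∀ σ : ℝ, ENNReal.ofReal (√(1 + σ ^ 2))⁻¹ * ENNReal.ofReal √(1 + σ ^ 2) = 1 := by
    intro σ
    rw [← ENNReal.ofReal_mul (by positivity), inv_mul_cancel₀ (by positivity), ENNReal.ofReal_one]
  have h2 : ∫⁻ σ, ‖g σ‖ₑ = ∫⁻ σ, ENNReal.ofReal (√(1 + σ ^ 2))⁻¹ *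
      (ENNReal.ofReal √(1 + σ ^ 2) * ‖g σ‖ₑ) := by
    simp_rw [← mul_assoc, hw, one_mul]
  have hg : Measurable fun σ => ‖g σ‖ₑ := g.continuous.enorm.measurable
  have h3 := sq_lintegral_mul_le (volume : Measure ℝ)
    (f := fun σ => ENNReal.ofReal (√(1 + σ ^ 2))⁻¹)
    (g := fun σ => ENNReal.ofReal √(1 + σ ^ 2) * ‖g σ‖ₑ) (by fun_prop) (by fun_prop)
  rw [← h2] at h3
  refine (pow_le_pow_left' h1 2).trans (h3.trans (le_of_eq ?_))
  congr 1
  · simp_rw [← ENNReal.ofReal_pow (inv_nonneg.2 (Real.sqrt_nonneg _)), inv_pow]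
    rw [← integral_univ_inv_one_add_sq, ofReal_integral_eq_lintegral_ofReal
      integrable_inv_one_add_sq (ae_of_all _ fun σ => by positivity)]
    congr 1; ext σ
    rw [Real.sq_sqrt (by positivity)]
  · congr 1; ext σ
    rw [mul_pow, ← ENNReal.ofReal_pow (Real.sqrt_nonneg _), Real.sq_sqrt (by positivity)]

theorem lintegral_sq_fourierInv (h : 𝓢(ℝ, ℂ)) :
    ∫⁻ r, ‖𝓕⁻ h r‖ₑ ^ 2 = ∫⁻ σ, ‖h σ‖ₑ ^ 2 := by
  rw [SchwartzMap.lintegral_enorm_sq, SchwartzMap.lintegral_enorm_sq,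
    ← SchwartzMap.integral_norm_sq_fourier (𝓕⁻ h), FourierTransform.fourier_fourierInv_eq]

/-- The increments of an inverse Fourier transform over disjoint intervals are controlled by the
`L²` norm of its derivative. -/
theorem sq_sum_enorm_fourierInv_sub_le (g : 𝓢(ℝ, ℂ)) {n : ℕ} (a b : Fin n → ℝ)
    (hab : ∀ i, a i ≤ b i)
    (hd : ∀ i j, i ≠ j → Disjoint (Set.Ioc (a i) (b i)) (Set.Ioc (a j) (b j))) :
    (∑ i, ‖𝓕⁻ g (b i) - 𝓕⁻ g (a i)‖ₑ) ^ 2 ≤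
      (ENNReal.ofReal (4 * Real.pi ^ 2) * ∫⁻ σ, ENNReal.ofReal (1 + σ ^ 2) * ‖g σ‖ₑ ^ 2) *
        ENNReal.ofReal (∑ i, (b i - a i)) := by
  -- Here `h σ = 2πiσ · g σ`, so `𝓕⁻ h` is the derivative of `𝓕⁻ g`.
  set h : 𝓢(ℝ, ℂ) := (2 * Real.pi * Complex.I) • SchwartzMap.smulLeftCLM ℂ (inner ℝ · (1 : ℝ)) g
    with hh
  have hinc : ∀ i, ‖𝓕⁻ g (b i) - 𝓕⁻ g (a i)‖ₑ ≤ ∫⁻ r in Set.Ioc (a i) (b i), ‖𝓕⁻ h r‖ₑ := by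
    intro i
    rw [← intervalIntegral.integral_eq_sub_of_hasDerivAt
      (fun r _ => hasDerivAt_fourierInv_schwartz g r) ((𝓕⁻ h).continuous.intervalIntegrable _ _),
      intervalIntegral.integral_of_le (hab i)]
    exact enorm_integral_le_lintegral_enorm _
  set U := ⋃ i, Set.Ioc (a i) (b i)
  have hU : MeasurableSet U := MeasurableSet.iUnion fun i => measurableSet_Ioc
  have hsum : ∑ i, ‖𝓕⁻ g (b i) - 𝓕⁻ g (a i)‖ₑ ≤ ∫⁻ r in U, ‖𝓕⁻ h r‖ₑ := by
    rw [lintegral_iUnion (fun i => measurableSet_Ioc) (fun i j hij => hd i j hij), tsum_fintype]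
    exact Finset.sum_le_sum fun i _ => hinc i
  have hvol : volume U ≤ ENNReal.ofReal (∑ i, (b i - a i)) := by
    refine (measure_iUnion_le _).trans (le_of_eq ?_)
    rw [tsum_fintype, ENNReal.ofReal_sum_of_nonneg fun i _ => sub_nonneg.2 (hab i)]
    simp
  have hm : Measurable fun r => ‖𝓕⁻ h r‖ₑ := (𝓕⁻ h).continuous.enorm.measurable
  have hcs := sq_lintegral_mul_le (volume.restrict U) (f := fun r => ‖𝓕⁻ h r‖ₑ)
    (g := fun _ => 1) hm.aemeasurable aemeasurable_const
  simp only [mul_one, one_pow, lintegral_one, Measure.restrict_apply_univ] at hcs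
  refine (pow_le_pow_left' hsum 2).trans (hcs.trans (mul_le_mul' ?_ hvol))
  refine (setLIntegral_le_lintegral _ _).trans ?_
  rw [lintegral_sq_fourierInv, ← lintegral_const_mul _ (by
    have := g.continuous.enorm.measurable; fun_prop)]
  refine lintegral_mono fun σ => ?_
  have hσ : ‖h σ‖ = 2 * Real.pi * |σ| * ‖g σ‖ := by
    rw [hh, smul_apply, SchwartzMap.smulLeftCLM_apply_apply (by fun_prop)]
    simp [abs_of_pos Real.pi_pos, mul_assoc]
  rw [← ofReal_norm, ← ofReal_norm, ← ENNReal.ofReal_pow (norm_nonneg _),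
    ← ENNReal.ofReal_pow (norm_nonneg _), ← ENNReal.ofReal_mul (by positivity),
    ← ENNReal.ofReal_mul (by positivity), hσ]
  refine ENNReal.ofReal_le_ofReal ?_
  rw [mul_pow, mul_pow, mul_pow, sq_abs]
  have : 0 ≤ Real.pi ^ 2 * ‖g σ‖ ^ 2 := by positivity
  nlinarith

end OneDimensional

/-! ### Polar coordinates and the average energy over directions. -/

section Polar

variable {E : Type*} [NormedAddCommGroup E] [InnerProductSpace ℝ E] [FiniteDimensional ℝ E]
  [MeasurableSpace E] [BorelSpace E]

/-- Integration in polar coordinates for nonnegative functions. -/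
theorem lintegral_toSphere_Ioi [Nontrivial E] (μ : Measure E) [μ.IsAddHaarMeasure] {g : E → ℝ≥0∞}
    (hg : Measurable g) :
    ∫⁻ θ : Metric.sphere (0 : E) 1, ∫⁻ σ in Set.Ioi (0 : ℝ),
      ENNReal.ofReal (σ ^ (Module.finrank ℝ E - 1)) * g (σ • (θ : E)) ∂volume ∂μ.toSphere =
      ∫⁻ x, g x ∂μ := by
  have h0 : ∫⁻ x, g x ∂μ = ∫⁻ x : ({0}ᶜ : Set E), g x ∂(μ.comap (↑)) := by
    rw [lintegral_subtype_comap (measurableSet_singleton (0 : E)).compl,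
      setLIntegral_congr (MeasureTheory.compl_mem_ae_iff.2 (measure_singleton (0 : E)) |>
        Filter.eventuallyEq_univ.2), Measure.restrict_univ]
  have h1 := (Measure.measurePreserving_homeomorphUnitSphereProd μ).symm
    (homeomorphUnitSphereProd E).toMeasurableEquiv
  rw [h0, ← h1.lintegral_comp (f := fun x : ({0}ᶜ : Set E) => g x) (by fun_prop),
    lintegral_prod _ (by
      refine Measurable.aemeasurable (hg.comp (measurable_subtype_coe.comp ?_))
      exact (homeomorphUnitSphereProd E).toMeasurableEquiv.symm.measurable)]
  congr 1
  ext θ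
  have hd : Measurable fun r : Set.Ioi (0 : ℝ) =>
      ENNReal.ofReal ((r : ℝ) ^ (Module.finrank ℝ E - 1)) := by fun_prop
  have hgm : Measurable fun σ : Set.Ioi (0 : ℝ) => g ((σ : ℝ) • (θ : E)) :=
    hg.comp (by fun_prop)
  have := lintegral_withDensity_eq_lintegral_mul (Measure.comap Subtype.val volume) hd hgm
  rw [← lintegral_subtype_comap measurableSet_Ioi
    (fun σ : ℝ => ENNReal.ofReal (σ ^ (Module.finrank ℝ E - 1)) * g (σ • (θ : E)))]
  exact this.symm

/-- Full lines instead of rays: reflection handles `σ < 0`, and space is covered twice. -/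
theorem lintegral_toSphere_line [Nontrivial E] (μ : Measure E) [μ.IsAddHaarMeasure] {g : E → ℝ≥0∞}
    (hg : Measurable g) :
    ∫⁻ θ : Metric.sphere (0 : E) 1, ∫⁻ σ : ℝ,
      ENNReal.ofReal (|σ| ^ (Module.finrank ℝ E - 1)) * g (σ • (θ : E)) ∂volume ∂μ.toSphere =
      2 * ∫⁻ x, g x ∂μ := by
  have h : ∀ θ : Metric.sphere (0 : E) 1, ∫⁻ σ : ℝ,
      ENNReal.ofReal (|σ| ^ (Module.finrank ℝ E - 1)) * g (σ • (θ : E)) =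
      (∫⁻ σ in Set.Ioi (0 : ℝ),
        ENNReal.ofReal (σ ^ (Module.finrank ℝ E - 1)) * g (σ • (θ : E))) +
      ∫⁻ σ in Set.Ioi (0 : ℝ),
        ENNReal.ofReal (σ ^ (Module.finrank ℝ E - 1)) * g (-(σ • (θ : E))) := by
    intro θ
    rw [← lintegral_add_compl _ (measurableSet_Ioi (a := (0 : ℝ))), Set.compl_Ioi]
    congr 1
    · refine setLIntegral_congr_fun measurableSet_Ioi fun σ hσ => ?_
      simp only [abs_of_pos (Set.mem_Ioi.1 hσ)]
    · rw [setLIntegral_congr Iio_ae_eq_Iic.symm,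
        ← (Measure.measurePreserving_neg (volume : Measure ℝ)).setLIntegral_comp_preimage_emb
          (MeasurableEquiv.neg ℝ).measurableEmbedding]
      simp only [Set.neg_preimage, Set.neg_Iio, neg_zero]
      refine setLIntegral_congr_fun measurableSet_Ioi fun σ hσ => ?_
      simp only [abs_neg, abs_of_pos (Set.mem_Ioi.1 hσ), neg_smul]
  simp_rw [h]
  rw [lintegral_add_left, lintegral_toSphere_Ioi μ hg,
    lintegral_toSphere_Ioi μ (g := fun x => g (-x)) (by fun_prop), two_mul]
  · congr 1
    exact (Measure.measurePreserving_neg μ).lintegral_comp hg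
  · refine Measurable.lintegral_prod_right' (f := fun p : Metric.sphere (0 : E) 1 × ℝ =>
      ENNReal.ofReal (p.2 ^ (Module.finrank ℝ E - 1)) * g (p.2 • (p.1 : E))) ?_
    fun_prop

/-- The weighted `L²` norm of the Fourier transform of `f` along the line spanned by `θ`. -/
noncomputable def lineEnergy (f : 𝓢(E, ℂ)) (θ : E) : ℝ≥0∞ :=
  ∫⁻ σ : ℝ, ENNReal.ofReal (1 + σ ^ 2) * ‖𝓕 f (σ • θ)‖ₑ ^ 2

theorem measurable_lineEnergy (f : 𝓢(E, ℂ)) : Measurable (lineEnergy f) := by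
  refine Measurable.lintegral_prod_right' (f := fun p : E × ℝ =>
    ENNReal.ofReal (1 + p.2 ^ 2) * ‖𝓕 f (p.2 • p.1)‖ₑ ^ 2) ?_
  have := (𝓕 f).continuous.measurable
  fun_prop

theorem lintegral_lineEnergy_le (hd : 3 ≤ Module.finrank ℝ E) (f : 𝓢(E, ℂ)) :
    ∫⁻ θ : Metric.sphere (0 : E) 1, lineEnergy f θ ∂(volume : Measure E).toSphere ≤
      4 * (volume : Measure E).toSphere Set.univ * (∫⁻ x, ‖f x‖ₑ) ^ 2 + 4 * ∫⁻ x, ‖f x‖ₑ ^ 2 := by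
  have : Nontrivial E := Module.nontrivial_of_finrank_pos (R := ℝ) (by omega)
  set N := ∫⁻ x, ‖f x‖ₑ
  have hm : Measurable (𝓕 f : 𝓢(E, ℂ)) := (𝓕 f).continuous.measurable
  have hsup : ∀ ξ, ‖𝓕 f ξ‖ₑ ≤ N := by
    intro ξ
    rw [SchwartzMap.fourier_coe, Real.fourier_eq]
    refine (enorm_integral_le_lintegral_enorm _).trans (lintegral_mono fun x => ?_)
    rw [Circle.smul_def, enorm_smul, ← ofReal_norm, Circle.norm_coe, ENNReal.ofReal_one, one_mul]
  -- Low frequencies use `|𝓕 f| ≤ ‖f‖₁`; for `|σ| ≥ 1`, `1 + σ² ≤ 2σ² ≤ 2|σ|^(d-1)`, which needs `d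
  -- ≥ 3`.
  have hpt : ∀ (θ : E) (σ : ℝ), ENNReal.ofReal (1 + σ ^ 2) * ‖𝓕 f (σ • θ)‖ₑ ^ 2 ≤
      (Set.Icc (-1 : ℝ) 1).indicator (fun _ => 2 * N ^ 2) σ +
      2 * (ENNReal.ofReal (|σ| ^ (Module.finrank ℝ E - 1)) * ‖𝓕 f (σ • θ)‖ₑ ^ 2) := by
    intro θ σ
    by_cases hσ : σ ∈ Set.Icc (-1 : ℝ) 1
    · rw [Set.indicator_of_mem hσ]
      refine le_add_right (mul_le_mul' ?_ (pow_le_pow_left' (hsup _) 2))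
      rw [← ENNReal.ofReal_ofNat]
      exact ENNReal.ofReal_le_ofReal (by nlinarith [hσ.1, hσ.2])
    · rw [Set.indicator_of_notMem hσ, zero_add, ← mul_assoc]
      refine mul_le_mul' ?_ le_rfl
      rw [← ENNReal.ofReal_ofNat, ← ENNReal.ofReal_mul (by norm_num)]
      refine ENNReal.ofReal_le_ofReal ?_
      have h1 : 1 ≤ |σ| := by
        by_contra! h
        exact hσ ⟨(abs_lt.1 h).1.le, (abs_lt.1 h).2.le⟩
      have h2 : |σ| ^ 2 ≤ |σ| ^ (Module.finrank ℝ E - 1) := pow_le_pow_right₀ h1 (by omega)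
      rw [← sq_abs]
      nlinarith
  have hint : ∀ θ : Metric.sphere (0 : E) 1, lineEnergy f θ ≤ 4 * N ^ 2 +
      2 * ∫⁻ σ : ℝ, ENNReal.ofReal (|σ| ^ (Module.finrank ℝ E - 1)) * ‖𝓕 f (σ • (θ : E))‖ₑ ^ 2 := by
    intro θ
    refine (lintegral_mono (hpt θ)).trans (le_of_eq ?_)
    rw [lintegral_add_left (measurable_const.indicator measurableSet_Icc),
      lintegral_indicator measurableSet_Icc, setLIntegral_const, Real.volume_Icc,
      lintegral_const_mul _ (by fun_prop)]
    congr 1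
    rw [mul_right_comm]
    congr 1
    rw [sub_neg_eq_add, one_add_one_eq_two, ENNReal.ofReal_ofNat]
    norm_num
  refine (lintegral_mono hint).trans (le_of_eq ?_)
  rw [lintegral_add_left measurable_const, lintegral_const, lintegral_const_mul,
    lintegral_toSphere_line volume (g := fun x => ‖𝓕 f x‖ₑ ^ 2) (by fun_prop)]
  · rw [← mul_assoc, mul_right_comm]
    congr 1
    norm_num
    rw [SchwartzMap.lintegral_enorm_sq, SchwartzMap.lintegral_enorm_sq, SchwartzMap.integral_norm_sq_fourier]
  · refine Measurable.lintegral_prod_right' (f := fun p : Metric.sphere (0 : E) 1 × ℝ =>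
      ENNReal.ofReal (|p.2| ^ (Module.finrank ℝ E - 1)) * ‖𝓕 f (p.2 • (p.1 : E))‖ₑ ^ 2) ?_
    fun_prop

end Polar

/-! ### Smooth approximation and a maximal inequality in `r`. -/

section Maximal

variable {E : Type*} [NormedAddCommGroup E] [InnerProductSpace ℝ E] [FiniteDimensional ℝ E]
  [MeasurableSpace E] [BorelSpace E]

omit [MeasurableSpace E] [BorelSpace E] in
theorem exists_schwartzMap_between_indicator {C U : Set E} (hC : IsCompact C) (hU : IsOpen U)
    (hCU : C ⊆ U) :
    ∃ (f : 𝓢(E, ℂ)) (u : E → ℝ), HasCompactSupport f ∧ (∀ x, f x = u x) ∧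
      (∀ x, C.indicator 1 x ≤ u x) ∧ ∀ x, u x ≤ U.indicator 1 x := by
  obtain ⟨L, hL, hCL, hLU⟩ := exists_compact_between hC hU hCU
  obtain ⟨u, hu, hur, hus, hu1⟩ := exists_contMDiff_support_eq_eq_one_iff (n := ⊤)
    (modelWithCornersSelf ℝ E) isOpen_interior hC.isClosed hCL
  have hrange : ∀ x, u x ∈ Set.Icc (0 : ℝ) 1 := fun x => hur (Set.mem_range_self x)
  have hcs : HasCompactSupport u := by
    refine HasCompactSupport.of_support_subset_isCompact hL ?_
    rw [hus]
    exact interior_subset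
  have hcs' : HasCompactSupport fun x => (u x : ℂ) := hcs.comp_left (g := Complex.ofReal) rfl
  have hsm : ContDiff ℝ ((⊤ : ℕ∞) : WithTop ℕ∞) fun x => (u x : ℂ) := Complex.ofRealCLM.contDiff.comp hu.contDiff
  refine ⟨hcs'.toSchwartzMap hsm, u, hcs', fun x => rfl, fun x => ?_, fun x => ?_⟩
  · by_cases hx : x ∈ C
    · simp [hx, (hu1 x).1 hx]
    · simp [hx, (hrange x).1]
  · by_cases hx : x ∈ U
    · simp [hx, (hrange x).2]
    · have : x ∉ Function.support u := by
        rw [hus]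
        exact fun h => hx (hLU (interior_subset h))
      simp [hx, Function.notMem_support.1 this]

theorem lintegral_lineEnergy_le_of_le_indicator (hd : 3 ≤ Module.finrank ℝ E) {C U : Set E}
    (hU : MeasurableSet U) {f : 𝓢(E, ℂ)} {u : E → ℝ} (hfu : ∀ x, f x = u x)
    (hCu : ∀ x, C.indicator 1 x ≤ u x) (huU : ∀ x, u x ≤ U.indicator 1 x) :
    ∫⁻ θ : Metric.sphere (0 : E) 1, lineEnergy f θ ∂(volume : Measure E).toSphere ≤
      4 * (volume : Measure E).toSphere Set.univ * volume U ^ 2 + 4 * volume U := by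
  have hle : ∀ x, ‖f x‖ₑ ≤ U.indicator 1 x := by
    intro x
    have h0 : 0 ≤ u x := (Set.indicator_nonneg (fun _ _ => zero_le_one) x).trans (hCu x)
    rw [hfu, ← ofReal_norm, Complex.norm_real, Real.norm_of_nonneg h0]
    refine (ENNReal.ofReal_le_ofReal (huU x)).trans (le_of_eq ?_)
    by_cases hx : x ∈ U <;> simp [hx]
  refine (lintegral_lineEnergy_le hd f).trans ?_
  gcongr
  · exact (lintegral_mono hle).trans (lintegral_indicator_one hU).le
  · refine (lintegral_mono fun x => ?_).trans (lintegral_indicator_one hU).le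
    refine (pow_le_pow_left' (hle x) 2).trans ?_
    by_cases hx : x ∈ U <;> simp [hx]

instance isFiniteMeasureOnCompacts_hyperplaneMeasure (θ : E) (r : ℝ) :
    IsFiniteMeasureOnCompacts (hyperplaneMeasure θ r) :=
  ⟨fun _ hK => hyperplaneMeasure_lt_top_of_isBounded θ r hK.isBounded⟩

theorem integrable_hyperplaneMeasure (θ : E) (r : ℝ) {f : 𝓢(E, ℂ)} (hfc : HasCompactSupport f) :
    Integrable f (hyperplaneMeasure θ r) :=
  f.continuous.integrable_of_hasCompactSupport hfc

/-- The Radon transform of a smooth function squeezed between two indicators is squeezed between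
the measures of the sections. -/
theorem exists_fourierInv_fourierLine_eq_ofReal {θ : E} (hθ : ‖θ‖ = 1) (r : ℝ) {C U : Set E}
    (hC : MeasurableSet C) (hU : MeasurableSet U) {f : 𝓢(E, ℂ)} {u : E → ℝ}
    (hfc : HasCompactSupport f) (hfu : ∀ x, f x = u x)
    (hCu : ∀ x, C.indicator 1 x ≤ u x) (huU : ∀ x, u x ≤ U.indicator 1 x) :
    ∃ t : ℝ, 0 ≤ t ∧ 𝓕⁻ (fourierLine hθ f) r = (t : ℂ) ∧
      hyperplaneMeasure θ r C ≤ ENNReal.ofReal t ∧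
      ENNReal.ofReal t ≤ hyperplaneMeasure θ r U := by
  have h0 : ∀ x, 0 ≤ u x := fun x =>
    (Set.indicator_nonneg (fun _ _ => zero_le_one) x).trans (hCu x)
  have hint : Integrable u (hyperplaneMeasure θ r) := by
    have := (integrable_hyperplaneMeasure θ r hfc).re
    refine this.congr (ae_of_all _ fun x => ?_)
    simp [hfu]
  have hof : ENNReal.ofReal (∫ x, u x ∂hyperplaneMeasure θ r) =
      ∫⁻ x, ENNReal.ofReal (u x) ∂hyperplaneMeasure θ r :=
    ofReal_integral_eq_lintegral_ofReal hint (ae_of_all _ h0)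
  refine ⟨∫ x, u x ∂hyperplaneMeasure θ r, integral_nonneg h0, ?_, ?_, ?_⟩
  · rw [← integral_hyperplaneMeasure_eq_fourierInv hθ f hfc]
    simp_rw [hfu]
    exact integral_ofReal
  · rw [hof, ← lintegral_indicator_one hC]
    refine lintegral_mono fun x => ?_
    refine le_trans (le_of_eq ?_) (ENNReal.ofReal_le_ofReal (hCu x))
    by_cases hx : x ∈ C <;> simp [hx]
  · rw [hof, ← lintegral_indicator_one hU]
    refine lintegral_mono fun x => (ENNReal.ofReal_le_ofReal (huU x)).trans (le_of_eq ?_)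
    by_cases hx : x ∈ U <;> simp [hx]

theorem sq_hyperplaneMeasure_le_lineEnergy {θ : E} (hθ : ‖θ‖ = 1) (r : ℝ) {C U : Set E}
    (hC : MeasurableSet C) (hU : MeasurableSet U) {f : 𝓢(E, ℂ)} {u : E → ℝ}
    (hfc : HasCompactSupport f) (hfu : ∀ x, f x = u x)
    (hCu : ∀ x, C.indicator 1 x ≤ u x) (huU : ∀ x, u x ≤ U.indicator 1 x) :
    hyperplaneMeasure θ r C ^ 2 ≤ ENNReal.ofReal Real.pi * lineEnergy f θ := by
  obtain ⟨t, ht, hft, hCt, -⟩ :=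
    exists_fourierInv_fourierLine_eq_ofReal hθ r hC hU hfc hfu hCu huU
  refine le_trans ?_ (sq_enorm_fourierInv_le (fourierLine hθ f) r)
  rw [hft, ← ofReal_norm, Complex.norm_real, Real.norm_of_nonneg ht]
  exact pow_le_pow_left' hCt 2

/-- The maximal inequality for the Radon transform of an open set. -/
theorem exists_bound_sq_hyperplaneMeasure (hd : 3 ≤ Module.finrank ℝ E) {U : Set E}
    (hU : IsOpen U) :
    ∃ B : Metric.sphere (0 : E) 1 → ℝ≥0∞, Measurable B ∧
      (∀ (θ : Metric.sphere (0 : E) 1) (r : ℝ), hyperplaneMeasure (θ : E) r U ^ 2 ≤ B θ) ∧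
      ∫⁻ θ, B θ ∂(volume : Measure E).toSphere ≤ ENNReal.ofReal Real.pi *
        (4 * (volume : Measure E).toSphere Set.univ * volume U ^ 2 + 4 * volume U) := by
  obtain ⟨F, hF, hFU, hFun, hFmono⟩ := hU.exists_iUnion_isClosed
  set C : ℕ → Set E := fun k => F k ∩ Metric.closedBall 0 k
  have hCc : ∀ k, IsCompact (C k) := fun k => (isCompact_closedBall _ _).inter_left (hF k)
  have hCU : ∀ k, C k ⊆ U := fun k => Set.inter_subset_left.trans (hFU k)
  have hCmono : Monotone C := fun i j hij => Set.inter_subset_inter (hFmono hij)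
    (Metric.closedBall_subset_closedBall (by exact_mod_cast hij))
  have hCun : ⋃ k, C k = U := by
    refine Set.Subset.antisymm (Set.iUnion_subset hCU) fun x hx => ?_
    rw [← hFun] at hx
    obtain ⟨i, hi⟩ := Set.mem_iUnion.1 hx
    obtain ⟨j, hj⟩ := exists_nat_ge ‖x‖
    refine Set.mem_iUnion.2 ⟨max i j, hFmono (le_max_left i j) hi, ?_⟩
    rw [mem_closedBall_zero_iff]
    exact hj.trans (by exact_mod_cast le_max_right i j)
  choose f u hfc hfu hCu huU using fun k => exists_schwartzMap_between_indicator (hCc k) hU (hCU k)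
  have hA : ∀ k, Measurable fun θ : Metric.sphere (0 : E) 1 => lineEnergy (f k) (θ : E) :=
    fun k => (measurable_lineEnergy (f k)).comp measurable_subtype_coe
  have hmeas : ∀ k, Measurable fun θ : Metric.sphere (0 : E) 1 =>
      ENNReal.ofReal Real.pi * lineEnergy (f k) θ := fun k => (hA k).const_mul _
  -- The compact sets exhaust `U`, so the sup bounds for `f k` pass to `U`; Fatou bounds the
  -- integral of the liminf.
  refine ⟨fun θ => liminf (fun k => ENNReal.ofReal Real.pi * lineEnergy (f k) θ) atTop,
    Measurable.liminf hmeas, fun θ r => ?_, ?_⟩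
  · have hθ : ‖(θ : E)‖ = 1 := mem_sphere_zero_iff_norm.1 θ.2
    have ht := tendsto_measure_iUnion_atTop (μ := hyperplaneMeasure (θ : E) r) hCmono
    rw [hCun] at ht
    have ht2 := (ENNReal.continuous_pow 2).continuousAt.tendsto.comp ht
    rw [← ht2.liminf_eq]
    exact liminf_le_liminf (Eventually.of_forall fun k =>
      sq_hyperplaneMeasure_le_lineEnergy hθ r (hCc k).measurableSet hU.measurableSet (hfc k)
        (hfu k) (hCu k) (huU k))
  · refine (lintegral_liminf_le hmeas).trans ?_
    refine (liminf_le_liminf (Eventually.of_forall fun k => ?_)).trans (liminf_const _).le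
    rw [lintegral_const_mul _ (hA k)]
    gcongr
    exact lintegral_lineEnergy_le_of_le_indicator hd hU.measurableSet (hfu k) (hCu k) (huU k)

end Maximal

theorem absolutelyContinuousOnLine_of_sq_sum_le {f : ℝ → ℝ} {M : ℝ} (hM : 0 ≤ M)
    (h : ∀ (n : ℕ) (a b : Fin n → ℝ), (∀ i, a i ≤ b i) →
      (∀ i j, i ≠ j → Disjoint (Set.Ioc (a i) (b i)) (Set.Ioc (a j) (b j))) →
      (∑ i, |f (b i) - f (a i)|) ^ 2 ≤ M * ∑ i, (b i - a i)) :
    AbsolutelyContinuousOnLine f := by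
  intro ε hε
  -- `M + 1` rather than `M` allows `M = 0`.
  refine ⟨ε ^ 2 / (M + 1), by positivity, fun n a b hab hd hδ => ?_⟩
  refine lt_of_pow_lt_pow_left₀ 2 hε.le ((h n a b hab hd).trans_lt ?_)
  have h0 : 0 ≤ ∑ i, (b i - a i) := Finset.sum_nonneg fun i _ => sub_nonneg.2 (hab i)
  rw [lt_div_iff₀ (by positivity)] at hδ
  have : 0 < ε ^ 2 := by positivity
  nlinarith

theorem exists_isCompact_isOpen_sdiff_lt {X : Type*} [MetricSpace X] [ProperSpace X]
    [MeasurableSpace X] [BorelSpace X] (μ : Measure X) [μ.Regular]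
    {K V : Set X} (hK : NullMeasurableSet K μ) (hV : IsOpen V) (hKV : K ⊆ V) (hVfin : μ V ≠ ∞)
    {ε : ℝ≥0∞} (hε : ε ≠ 0) :
    ∃ C U, IsCompact C ∧ IsOpen U ∧ C ⊆ K ∧ K ⊆ U ∧ U ⊆ V ∧ μ (U \ C) < ε := by
  -- Inner regularity needs a measurable set, hence `K'`; outer regularity below applies to `K`
  -- itself.
  obtain ⟨K', hK'K, hK'm, hK'⟩ := hK.exists_measurable_subset_ae_eq
  have hKfin : μ K ≠ ∞ := ne_top_of_le_ne_top hVfin (measure_mono hKV)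
  have hε2 : ε / 2 ≠ 0 := (ENNReal.half_pos hε).ne'
  obtain ⟨C, hCK, hC, hCm⟩ := hK'm.exists_isCompact_lt_add
    (by rwa [measure_congr hK'] : μ K' ≠ ∞) hε2
  obtain ⟨U, hKU, hU, hUm⟩ := K.exists_isOpen_lt_add hKfin hε2
  refine ⟨C, U ∩ V, hC, hU.inter hV, hCK.trans hK'K, Set.subset_inter hKU hKV,
    Set.inter_subset_right, ?_⟩
  refine (measure_mono (Set.sdiff_subset_sdiff_left Set.inter_subset_left)).trans_lt ?_
  refine measure_sdiff_lt_of_lt_add hC.measurableSet.nullMeasurableSet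
    ((hCK.trans hK'K).trans hKU) hC.measure_lt_top.ne (hUm.trans_le ?_)
  rw [measure_congr hK'] at hCm
  calc μ K + ε / 2 ≤ (μ C + ε / 2) + ε / 2 := by gcongr
    _ = μ C + ε := by rw [add_assoc, ENNReal.add_halves]

/-! ### Almost every direction, all sections. -/

section Main

variable {E : Type*} [NormedAddCommGroup E] [InnerProductSpace ℝ E] [FiniteDimensional ℝ E]
  [MeasurableSpace E] [BorelSpace E]

/-- For open sets `V n` of rapidly decreasing volume and almost every direction `θ`, the measures of
all hyperplane sections of `V n` orthogonal to `θ` tend to zero. -/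
theorem ae_forall_tendsto_hyperplaneMeasure (hd : 3 ≤ Module.finrank ℝ E) {V : ℕ → Set E}
    (hV : ∀ n, IsOpen (V n)) (hvol : ∀ n, volume (V n) ≤ 2⁻¹ ^ n) :
    ∀ᵐ θ : Metric.sphere (0 : E) 1 ∂(volume : Measure E).toSphere,
      ∀ r, Tendsto (fun n => hyperplaneMeasure (θ : E) r (V n)) atTop (𝓝 0) := by
  choose B hBm hB hBint using fun n => exists_bound_sq_hyperplaneMeasure hd (hV n)
  set S := (volume : Measure E).toSphere Set.univ
  have hle : ∀ n, ∫⁻ θ, B n θ ∂(volume : Measure E).toSphere ≤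
      ENNReal.ofReal Real.pi * (4 * S + 4) * 2⁻¹ ^ n := by
    intro n
    refine (hBint n).trans ?_
    rw [mul_assoc (ENNReal.ofReal Real.pi), add_mul]
    have h1 : volume (V n) ^ 2 ≤ 2⁻¹ ^ n := by
      rw [sq]
      refine (mul_le_mul' ((hvol n).trans (pow_le_one' ?_ n)) (hvol n)).trans_eq (one_mul _)
      exact ENNReal.inv_le_one.2 one_le_two
    gcongr
    exact hvol n
  have hsum : ∫⁻ θ, ∑' n, B n θ ∂(volume : Measure E).toSphere ≠ ∞ := by
    rw [lintegral_tsum fun n => (hBm n).aemeasurable]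
    refine ne_top_of_le_ne_top ?_ (ENNReal.tsum_le_tsum hle)
    rw [ENNReal.tsum_mul_left, ENNReal.tsum_geometric]
    have hS : S ≠ ∞ := measure_ne_top _ _
    refine ENNReal.mul_ne_top (ENNReal.mul_ne_top ENNReal.ofReal_ne_top ?_) ?_
    · exact ENNReal.add_ne_top.2 ⟨ENNReal.mul_ne_top (by simp) hS, by simp⟩
    · simp
  -- `B n θ` does not depend on `r`, so one exceptional null set serves all sections.
  filter_upwards [ae_lt_top (Measurable.tsum hBm) hsum] with θ hθ r
  have h0 := ENNReal.tendsto_atTop_zero_of_tsum_ne_top hθ.ne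
  have h1 : Tendsto (fun n => hyperplaneMeasure (θ : E) r (V n) ^ 2) atTop (𝓝 0) :=
    tendsto_of_tendsto_of_tendsto_of_le_of_le tendsto_const_nhds h0 (fun _ => zero_le)
      fun n => hB n θ r
  have h2 := (ENNReal.continuous_rpow_const (y := (2 : ℝ)⁻¹)).continuousAt.tendsto.comp h1
  rw [ENNReal.zero_rpow_of_pos (by norm_num)] at h2
  refine h2.congr fun n => ?_
  rw [Function.comp_apply, ← ENNReal.rpow_natCast, ← ENNReal.rpow_mul]
  norm_num

theorem ae_nullMeasurableSet_and_absolutelyContinuousOnLine (hd : 3 ≤ Module.finrank ℝ E) {K : Set E}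
    (hKb : Bornology.IsBounded K) (hK : NullMeasurableSet K volume) :
    ∀ᵐ θ : Metric.sphere (0 : E) 1 ∂(volume : Measure E).toSphere,
      (∀ r, NullMeasurableSet K (hyperplaneMeasure (θ : E) r)) ∧
      AbsolutelyContinuousOnLine fun r => (hyperplaneMeasure (θ : E) r K).toReal := by
  obtain ⟨R, hR⟩ := hKb.subset_ball 0
  set S := (volume : Measure E).toSphere Set.univ
  have hS : S ≠ ∞ := measure_ne_top _ _
  choose C U hC hU hCK hKU hUR hUC using fun n : ℕ =>
    exists_isCompact_isOpen_sdiff_lt volume hK Metric.isOpen_ball hR measure_ball_lt_top.ne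
      (ε := 2⁻¹ ^ n) (pow_ne_zero _ (by simp))
  choose f u hfc hfu hCu huU using fun n =>
    exists_schwartzMap_between_indicator (hC n) (hU n) ((hCK n).trans (hKU n))
  have hA : ∀ n, Measurable fun θ : Metric.sphere (0 : E) 1 => lineEnergy (f n) (θ : E) :=
    fun n => (measurable_lineEnergy (f n)).comp measurable_subtype_coe
  have hEn : ∫⁻ θ : Metric.sphere (0 : E) 1, liminf (fun n => lineEnergy (f n) (θ : E)) atTop
      ∂(volume : Measure E).toSphere ≠ ∞ := by
    refine ne_top_of_le_ne_top (b := 4 * S * volume (Metric.ball (0 : E) R) ^ 2 +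
      4 * volume (Metric.ball (0 : E) R)) ?_ ((lintegral_liminf_le hA).trans
        ((liminf_le_liminf (Eventually.of_forall fun n => ?_)).trans (liminf_const _).le))
    · have : volume (Metric.ball (0 : E) R) ≠ ∞ := measure_ball_lt_top.ne
      finiteness
    · refine (lintegral_lineEnergy_le_of_le_indicator hd (hU n).measurableSet (hfu n) (hCu n)
        (huU n)).trans ?_
      gcongr <;> exact hUR n
  filter_upwards [ae_lt_top (Measurable.liminf hA) hEn,
    ae_forall_tendsto_hyperplaneMeasure hd (fun n => (hU n).sdiff (hC n).isClosed)
      fun n => (hUC n).le] with θ hlim hV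
  have hθ : ‖(θ : E)‖ = 1 := mem_sphere_zero_iff_norm.1 θ.2
  have hfin : ∀ r, hyperplaneMeasure (θ : E) r K ≠ ∞ := fun r =>
    (hyperplaneMeasure_lt_top_of_isBounded _ r hKb).ne
  constructor
  · intro r
    -- This remainder lies in every `U n \ C n`.
    have hnull : hyperplaneMeasure (θ : E) r (K \ ⋃ n, C n) = 0 := by
      refine le_antisymm (ge_of_tendsto' (hV r) fun n => measure_mono ?_) zero_le
      exact Set.sdiff_subset_sdiff (hKU n) (Set.subset_iUnion C n)
    rw [← Set.union_sdiff_cancel (Set.iUnion_subset hCK)]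
    exact (MeasurableSet.iUnion fun n => (hC n).measurableSet).nullMeasurableSet.union
      (NullMeasurableSet.of_null hnull)
  choose t ht hft hCt htU using fun n r => exists_fourierInv_fourierLine_eq_ofReal hθ r
    (hC n).measurableSet (hU n).measurableSet (hfc n) (hfu n) (hCu n) (huU n)
  have htend : ∀ r, Tendsto (fun n => t n r) atTop
      (𝓝 (hyperplaneMeasure (θ : E) r K).toReal) := by
    intro r
    have hUle : ∀ n, hyperplaneMeasure (θ : E) r (U n) ≤
        hyperplaneMeasure (θ : E) r (C n) + hyperplaneMeasure (θ : E) r (U n \ C n) := fun n =>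
      (measure_mono (by rw [Set.union_sdiff_self]; exact Set.subset_union_right)).trans
        (measure_union_le _ _)
    have hup : Tendsto (fun n => hyperplaneMeasure (θ : E) r K +
        hyperplaneMeasure (θ : E) r (U n \ C n)) atTop (𝓝 (hyperplaneMeasure (θ : E) r K)) := by
      simpa using tendsto_const_nhds.add (hV r)
    have hlow : Tendsto (fun n => hyperplaneMeasure (θ : E) r K -
        hyperplaneMeasure (θ : E) r (U n \ C n)) atTop (𝓝 (hyperplaneMeasure (θ : E) r K)) := by
      simpa using ENNReal.Tendsto.sub tendsto_const_nhds (hV r) (Or.inl (hfin r))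
    have hmid : Tendsto (fun n => ENNReal.ofReal (t n r)) atTop
        (𝓝 (hyperplaneMeasure (θ : E) r K)) := by
      refine tendsto_of_tendsto_of_tendsto_of_le_of_le hlow hup (fun n => ?_) fun n => ?_
      · refine tsub_le_iff_right.2 ((measure_mono (hKU n)).trans ((hUle n).trans ?_))
        gcongr
        exact hCt n r
      · refine (htU n r).trans ((hUle n).trans ?_)
        gcongr
        exact hCK n
    refine ((ENNReal.tendsto_toReal (hfin r)).comp hmid).congr fun n => ?_
    exact ENNReal.toReal_ofReal (ht n r)
  obtain ⟨c, hc, hctop⟩ := exists_between hlim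
  refine absolutelyContinuousOnLine_of_sq_sum_le (M := 4 * Real.pi ^ 2 * c.toReal)
    (by positivity) fun n a b hab hdis => ?_
  -- The full sequence converges, so the energy bound `c` is needed only for infinitely many `k`,
  -- which is what a finite liminf gives.
  have hlimsum : Tendsto (fun k => (∑ i, |t k (b i) - t k (a i)|) ^ 2) atTop
      (𝓝 ((∑ i, |(hyperplaneMeasure (θ : E) (b i) K).toReal -
        (hyperplaneMeasure (θ : E) (a i) K).toReal|) ^ 2)) :=
    (tendsto_finsetSum _ fun i _ => ((htend (b i)).sub (htend (a i))).abs).pow 2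
  refine le_of_tendsto_of_frequently hlimsum ((frequently_lt_of_liminf_lt (h := hc)).mono
    fun k hk => ?_)
  have h0 : 0 ≤ ∑ i, (b i - a i) := Finset.sum_nonneg fun i _ => sub_nonneg.2 (hab i)
  have hb := sq_sum_enorm_fourierInv_sub_le (fourierLine hθ (f k)) a b hab hdis
  have he : ∀ i, ‖𝓕⁻ (fourierLine hθ (f k)) (b i) - 𝓕⁻ (fourierLine hθ (f k)) (a i)‖ₑ =
      ENNReal.ofReal |t k (b i) - t k (a i)| := by
    intro i
    rw [hft, hft, ← Complex.ofReal_sub, ← ofReal_norm, Complex.norm_real, Real.norm_eq_abs]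
  simp_rw [he] at hb
  rw [← ENNReal.ofReal_sum_of_nonneg fun i _ => abs_nonneg _,
    ← ENNReal.ofReal_pow (Finset.sum_nonneg fun i _ => abs_nonneg _)] at hb
  have hk' : ∫⁻ σ, ENNReal.ofReal (1 + σ ^ 2) * ‖fourierLine hθ (f k) σ‖ₑ ^ 2 ≤
      ENNReal.ofReal c.toReal := by
    rw [ENNReal.ofReal_toReal hctop.ne]
    exact hk.le
  have hfinal := hb.trans (mul_le_mul' (mul_le_mul' le_rfl hk') le_rfl)
  rw [← ENNReal.ofReal_mul (by positivity), ← ENNReal.ofReal_mul (by positivity)] at hfinal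
  exact (ENNReal.ofReal_le_ofReal_iff (by positivity)).1 hfinal

end Main

/-! ### Transfer to Hausdorff measure on Euclidean space. -/

theorem theoremt (d : ℕ) (hd : 3 ≤ d) (K : Set (EuclideanSpace ℝ (Fin d)))
    (hK_bdd : Bornology.IsBounded K) (hK_meas : NullMeasurableSet K volume) :
    ∀ᵐ θ : Metric.sphere (0 : EuclideanSpace ℝ (Fin d)) 1
        ∂((volume : Measure (EuclideanSpace ℝ (Fin d))).toSphere),
      (∀ r : ℝ, NullMeasurableSet
        (hyperplaneSection K (θ : EuclideanSpace ℝ (Fin d)) r) μHE[d - 1]) ∧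
      AbsolutelyContinuousOnLine (radonTransform K (θ : EuclideanSpace ℝ (Fin d))) := by
  have hdim : Module.finrank ℝ (EuclideanSpace ℝ (Fin d)) = d := finrank_euclideanSpace_fin
  filter_upwards [ae_nullMeasurableSet_and_absolutelyContinuousOnLine (by rwa [hdim]) hK_bdd hK_meas]
    with θ ⟨h1, h2⟩
  have hθ : ‖(θ : EuclideanSpace ℝ (Fin d))‖ = 1 := mem_sphere_zero_iff_norm.1 θ.2
  have hH : ∀ r : ℝ, MeasurableSet
      {x : EuclideanSpace ℝ (Fin d) | inner ℝ x (θ : EuclideanSpace ℝ (Fin d)) = r} := fun r =>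
    (isClosed_eq (by fun_prop) continuous_const).measurableSet
  have hr := fun r => hyperplaneMeasure_eq_restrict hθ r
  simp only [hdim] at hr
  constructor
  · intro r
    have := h1 r
    rw [hr] at this
    exact (nullMeasurableSet_restrict (hH r).nullMeasurableSet).1 this
  · convert! h2 using 2 with r
    rw [hr, Measure.restrict_apply' (hH r)]
    rfl
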